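/- Let $A$ be one of the following rings, and put $K=\mathbb C$ in cases (1) and (2), $K=\mathbb R$ in case (3): 1. the ring of entire functions $\mathbb C\to\mathbb C$; 2. the ring of functions $\mathbb C\to\mathbb C$ of the form $\sum_{n\ge 0}a_nz^n$, convergent for every $z\in\mathbb C$, with all $a_n\in\mathbb R$; 3. the ring of real analytic functions $\mathbb R\to\mathbb R$. Let $\mathfrak M(A)$ be the set of maximal ideals of $A$ with the Stone (hull-kernel) topology, in which the sets $\{M : f\in M\}$, $f\in A$, form a base of closed sets. For $f\in A$ put $Z_f=\{x\in K: f(x)=0\}$, and for an ideal $M$ put $Z[M]=\{Z_f: f\in M\}$. Let $\mathcal D(K)$ consist of the closed discrete subsets of $K$ together with $K$ itself, and let $\mathcal D_{\mathrm{sym}}(\mathbb C)$ be the set of members of $\mathcal D(\mathbb C)$ that are stable under complex conjugation. For a family $\mathcal D$ among these, a *discrete $z$-filter* in $\mathcal D$ is a set $\mathcal F\subseteq\mathcal D$ such that $\emptyset\notin\mathcal F$; $D_1\cap D_2\in\mathcal F$ whenever $D_1,D_2\in\mathcal F$; and $D\in\mathcal F$ whenever $D\in\mathcal D$ contains a member of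 $\mathcal F$. A *discrete $z$-ultrafilter* is an inclusion-maximal discrete $z$-filter. Let $\theta K$ (respectively $\theta_{\mathrm{sym}}\mathbb C$) be the set of discrete $z$-ultrafilters in $\mathcal D(K)$ (respectively in $\mathcal D_{\mathrm{sym}}(\mathbb C)$), with the topology in which the sets $\overline Z=\{\mathcal F: Z\in\mathcal F\}$, $Z$ in the family, form a base of closed sets. Then, for each of the three rings, $\mathfrak M(A)$ is homeomorphic to $\theta K$. Moreover, in cases (1) and (3) the map $M\mapsto Z[M]$ is a homeomorphism from $\mathfrak M(A)$ onto $\theta K$, and in case (2) the map $M\mapsto Z[M]$ is a homeomorphism from $\mathfrak M(A)$ onto $\theta_{\mathrm{sym}}\mathbb C$. -/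

import Mathlib

/-- The ring of entire functions of one complex variable. -/
def entireFunctions : Subring (ℂ → ℂ) where
  carrier := {f | Differentiable ℂ f}
  mul_mem' hf hg := hf.mul hg
  one_mem' := differentiable_const 1
  add_mem' hf hg := hf.add hg
  zero_mem' := differentiable_const 0
  neg_mem' hf := hf.neg

/-- The ring of functions on `ℂ` given by an everywhere convergent power series
`∑ aₙ zⁿ` with real coefficients `aₙ`. -/
def realEntireFunctions : Subring (ℂ → ℂ) where
  carrier := {f | ∃ a : ℕ → ℝ, ∀ z : ℂ, HasSum (fun n => (a n : ℂ) * z ^ n) (f z)}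
  mul_mem' := by
    rintro f g ⟨a, ha⟩ ⟨b, hb⟩
    refine ⟨fun n => ∑ p ∈ Finset.HasAntidiagonal.antidiagonal n, a p.1 * b p.2, fun z => ?_⟩
    have hs := (summable_norm_sum_mul_antidiagonal_of_summable_norm
      (ha z).summable.norm (hb z).summable.norm).of_norm.hasSum
    rw [← tsum_mul_tsum_eq_tsum_sum_antidiagonal_of_summable_norm
      (ha z).summable.norm (hb z).summable.norm, (ha z).tsum_eq, (hb z).tsum_eq] at hs
    refine (iff_of_eq <| congrArg (fun u : ℕ → ℂ => HasSum u _) (funext fun n => ?_)).mpr hs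
    push_cast
    rw [Finset.sum_mul]
    refine Finset.sum_congr rfl fun p hp => ?_
    rw [← Finset.HasAntidiagonal.mem_antidiagonal.mp hp, pow_add]
    ring
  one_mem' := by
    refine ⟨fun n => if n = 0 then 1 else 0, fun z => ?_⟩
    have h := hasSum_ite_eq (0 : ℕ) (1 : ℂ)
    refine (iff_of_eq <| congrArg (fun u : ℕ → ℂ => HasSum u _) (funext fun n => ?_)).mpr h
    by_cases h : n = 0 <;> simp [h]
  add_mem' := by
    rintro f g ⟨a, ha⟩ ⟨b, hb⟩
    refine ⟨fun n => a n + b n, fun z => ?_⟩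
    have h := (ha z).add (hb z)
    refine (iff_of_eq <| congrArg (fun u : ℕ → ℂ => HasSum u _) (funext fun n => ?_)).mpr h
    push_cast
    ring
  zero_mem' := ⟨fun _ => 0, fun z => by simp⟩
  neg_mem' := by
    rintro f ⟨a, ha⟩
    refine ⟨fun n => -a n, fun z => ?_⟩
    have h := (ha z).neg
    refine (iff_of_eq <| congrArg (fun u : ℕ → ℂ => HasSum u _) (funext fun n => ?_)).mpr h
    push_cast
    ring

/-- The ring of real analytic functions on `ℝ`. -/
def realAnalyticFunctions : Subring (ℝ → ℝ) where
  carrier := {f | ∀ x, AnalyticAt ℝ f x}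
  mul_mem' hf hg := fun x => (hf x).mul (hg x)
  one_mem' := fun _ => analyticAt_const
  add_mem' hf hg := fun x => (hf x).add (hg x)
  zero_mem' := fun _ => analyticAt_const
  neg_mem' hf := fun x => (hf x).neg

/-- The zero set `Z_f`. -/
def zeroSet {K : Type*} [Zero K] (f : K → K) : Set K := {x | f x = 0}

/-- `Z[I] = {Z_f : f ∈ I}` for an ideal `I` of a ring of `K`-valued functions on `K`. -/
def zeroSetsOf {K : Type*} [CommRing K] {R : Subring (K → K)} (I : Ideal R) : Set (Set K) :=
  {Z | ∃ f : R, f ∈ I ∧ Z = zeroSet (f : K → K)}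

/-- The closed discrete subsets of `X`, together with the special member `X`. -/
def closedDiscreteSets (X : Type*) [TopologicalSpace X] : Set (Set X) :=
  {Z | (IsClosed Z ∧ IsDiscrete Z) ∨ Z = Set.univ}

/-- The closed discrete subsets of `ℂ` symmetric about the real axis, together with `ℂ`. -/
def symmetricClosedDiscreteSets : Set (Set ℂ) :=
  {Z | Z ∈ closedDiscreteSets ℂ ∧ ∀ z ∈ Z, (starRingEnd ℂ) z ∈ Z}

/-- Discrete `z`-filters, formed inside a given family `D` of subsets of `X`. -/
structure IsDiscreteZFilter {X : Type*} (D : Set (Set X)) (F : Set (Set X)) : Prop where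
  subset : F ⊆ D
  empty_notMem : ∅ ∉ F
  inter_mem : ∀ Z₁ ∈ F, ∀ Z₂ ∈ F, Z₁ ∩ Z₂ ∈ F
  mem_of_superset : ∀ Z₁ ∈ F, ∀ Z ∈ D, Z₁ ⊆ Z → Z ∈ F

/-- The set of discrete `z`-ultrafilters, that is, of inclusion-maximal discrete `z`-filters,
formed inside the family `D`. -/
def DiscreteZUltrafilter {X : Type*} (D : Set (Set X)) : Type _ :=
  {F : Set (Set X) // Maximal (IsDiscreteZFilter D) F}

/-- The basic closed set `Z̅ = {p : Z ∈ 𝒟ᵖ}`. -/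
def basicClosed {X : Type*} (D : Set (Set X)) (Z : Set X) : Set (DiscreteZUltrafilter D) :=
  {p | Z ∈ p.1}

/-- The topology generated by the complements of the sets `Z̅`, `Z ∈ D`. -/
instance DiscreteZUltrafilter.instTopologicalSpace {X : Type*} (D : Set (Set X)) :
    TopologicalSpace (DiscreteZUltrafilter D) :=
  TopologicalSpace.generateFrom {U | ∃ Z ∈ D, U = (basicClosed D Z)ᶜ}

/-- If `D` contains the empty set and is closed under finite unions and intersections, then
the sets `Z̅`, `Z ∈ D`, are a base of closed sets of this topology, not merely a subbase. -/
theorem isTopologicalBasis_compl_basicClosed {X : Type*} (D : Set (Set X)) (h0 : ∅ ∈ D)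
    (hu : ∀ Z₁ ∈ D, ∀ Z₂ ∈ D, Z₁ ∪ Z₂ ∈ D) (hi : ∀ Z₁ ∈ D, ∀ Z₂ ∈ D, Z₁ ∩ Z₂ ∈ D) :
    TopologicalSpace.IsTopologicalBasis {U | ∃ Z ∈ D, U = (basicClosed D Z)ᶜ} := by
  -- a set of `D` that is not in `p` is disjoint from some member of `p`
  have key : ∀ (p : DiscreteZUltrafilter D) (A : Set X), A ∈ D → p.1.Nonempty → A ∉ p.1 →
      ∃ B ∈ p.1, A ∩ B = ∅ := by
    intro p A hA hne hAp
    by_contra! hcon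
    have hF : IsDiscreteZFilter D {Z | Z ∈ D ∧ ∃ B ∈ p.1, A ∩ B ⊆ Z} := by
      refine ⟨fun Z hZ => hZ.1, ?_, ?_, ?_⟩
      · rintro ⟨-, B, hB, hAB⟩
        exact (hcon B hB).ne_empty (Set.subset_empty_iff.mp hAB)
      · rintro Z₁ ⟨h1, B₁, hB₁, s1⟩ Z₂ ⟨h2, B₂, hB₂, s2⟩
        exact ⟨hi _ h1 _ h2, B₁ ∩ B₂, p.2.1.inter_mem _ hB₁ _ hB₂, fun x hx =>
          ⟨s1 ⟨hx.1, hx.2.1⟩, s2 ⟨hx.1, hx.2.2⟩⟩⟩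
      · rintro Z₁ ⟨h1, B, hB, s⟩ Z hZ hs
        exact ⟨hZ, B, hB, s.trans hs⟩
    obtain ⟨B, hB⟩ := hne
    exact hAp (p.2.2 hF
      (fun C hC => ⟨p.2.1.subset hC, C, hC, Set.inter_subset_right⟩)
      ⟨hA, B, hB, Set.inter_subset_left⟩)
  refine ⟨?_, ?_, rfl⟩
  · rintro _ ⟨Z₁, h1, rfl⟩ _ ⟨Z₂, h2, rfl⟩ p ⟨hp1, hp2⟩
    refine ⟨_, ⟨Z₁ ∪ Z₂, hu _ h1 _ h2, rfl⟩, fun h => ?_, fun q hq => ?_⟩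
    · have h' : Z₁ ∪ Z₂ ∈ p.1 := h
      obtain ⟨B₁, hB₁, e1⟩ := key p Z₁ h1 ⟨_, h'⟩ hp1
      obtain ⟨B₂, hB₂, e2⟩ := key p Z₂ h2 ⟨_, h'⟩ hp2
      have hm := p.2.1.inter_mem _ h' _ (p.2.1.inter_mem _ hB₁ _ hB₂)
      refine p.2.1.empty_notMem ?_
      convert hm
      refine (Set.eq_empty_of_forall_notMem ?_).symm
      rintro x ⟨hx | hx, hx1, hx2⟩
      · exact (e1 ▸ (⟨hx, hx1⟩ : x ∈ Z₁ ∩ B₁) : x ∈ (∅ : Set X))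
      · exact (e2 ▸ (⟨hx, hx2⟩ : x ∈ Z₂ ∩ B₂) : x ∈ (∅ : Set X))
    · exact ⟨fun h => hq (q.2.1.mem_of_superset _ h _ (hu _ h1 _ h2) Set.subset_union_left),
        fun h => hq (q.2.1.mem_of_superset _ h _ (hu _ h1 _ h2) Set.subset_union_right)⟩
  · refine Set.eq_univ_of_forall fun p => ?_
    exact ⟨_, ⟨∅, h0, rfl⟩, p.2.1.empty_notMem⟩

/-- `θK`, the space of discrete `z`-ultrafilters on `K`. -/
abbrev Theta (K : Type*) [TopologicalSpace K] : Type _ :=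
  DiscreteZUltrafilter (closedDiscreteSets K)

/-- The space of discrete `z`-ultrafilters of symmetric closed discrete subsets of `ℂ`. -/
abbrev ThetaSymm : Type :=
  DiscreteZUltrafilter symmetricClosedDiscreteSets

/-! The correspondence is formal once two facts about the ring are known: its zero sets are exactly
the members of `D`, and functions of an ideal without common zero generate the unit ideal. Then
membership in a maximal ideal depends only on the zero set, `Z[M]` is an ultrafilter, every
ultrafilter arises this way, and basic open sets correspond to basic open sets.

The first fact is Weierstrass's theorem (`exists_differentiable_zeroSet_eq`): for real coefficients,
multiply the function by its conjugate reflection; on the line, take the squared modulus of a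
complex solution. The second is the Bézout identity for entire functions (`exists_bezout`), averaged
with its conjugate for real coefficients; on the line, a sum of squares is already a unit.

To compare `ThetaSymm` with `Theta ℂ`, note that a set is closed and discrete iff it has finitely
many points in each annulus `n ≤ |z| < n + 1`. This sees only the integer part of the modulus, so a
possibly discontinuous surjection that preserves it and glues exactly the conjugate pairs matches
symmetric sets with arbitrary ones. -/

/-! ### Maximal ideals and ultrafilters of zero sets -/

/-- If `h` were outside `M`, then `y * h + i = 1` for some `i ∈ M`, and `f`, `g`, `i` would have no
common zero. This is why `hR` concerns three functions; it spares any discussion of greatest common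
divisors. -/
theorem mem_of_zeroSet_inter_subset {K : Type*} [Field K] {R : Subring (K → K)}
    (hR : ∀ (I : Ideal R) (f g k : R), f ∈ I → g ∈ I → k ∈ I →
      (∀ x, (f : K → K) x = 0 → (g : K → K) x = 0 → (k : K → K) x ≠ 0) → I = ⊤)
    {M : Ideal R} (hM : M.IsMaximal) {f g h : R} (hf : f ∈ M) (hg : g ∈ M)
    (hh : zeroSet (f : K → K) ∩ zeroSet (g : K → K) ⊆ zeroSet (h : K → K)) : h ∈ M := by
  by_contra hn
  obtain ⟨y, i, hi, e⟩ := hM.exists_inv hn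
  refine hM.ne_top (hR M f g i hf hg hi fun x hfx hgx hix => ?_)
  have hhx : (h : K → K) x = 0 := hh ⟨hfx, hgx⟩
  have := congrFun (congrArg (Subtype.val) e) x
  simp [hhx, hix] at this

theorem maximal_zeroSetsOf {K : Type*} [Field K] {R : Subring (K → K)} {D : Set (Set K)}
    (hD : ∀ Z, Z ∈ D ↔ ∃ f : R, Z = zeroSet (f : K → K))
    (hi : ∀ Z₁ ∈ D, ∀ Z₂ ∈ D, Z₁ ∩ Z₂ ∈ D)
    (hR : ∀ (I : Ideal R) (f g k : R), f ∈ I → g ∈ I → k ∈ I →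
      (∀ x, (f : K → K) x = 0 → (g : K → K) x = 0 → (k : K → K) x ≠ 0) → I = ⊤)
    {M : Ideal R} (hM : M.IsMaximal) : Maximal (IsDiscreteZFilter D) (zeroSetsOf M) := by
  refine ⟨⟨?_, ?_, ?_, ?_⟩, ?_⟩
  · rintro _ ⟨f, -, rfl⟩
    exact (hD _).2 ⟨f, rfl⟩
  · rintro ⟨f, hf, e⟩
    refine hM.ne_top (hR M f f f hf hf hf fun x hx _ _ => ?_)
    exact (e ▸ (show x ∈ zeroSet (f : K → K) from hx) : x ∈ (∅ : Set K))
  · rintro _ ⟨f, hf, rfl⟩ _ ⟨g, hg, rfl⟩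
    obtain ⟨h, e⟩ := (hD _).1 (hi _ ((hD _).2 ⟨f, rfl⟩) _ ((hD _).2 ⟨g, rfl⟩))
    exact ⟨h, mem_of_zeroSet_inter_subset hR hM hf hg e.subset, e⟩
  · rintro _ ⟨f, hf, rfl⟩ Z hZ hs
    obtain ⟨h, rfl⟩ := (hD _).1 hZ
    exact ⟨h, mem_of_zeroSet_inter_subset hR hM hf hf (Set.inter_subset_left.trans hs), rfl⟩
  · intro F hF hs Z hZ
    obtain ⟨h, rfl⟩ := (hD _).1 (hF.subset hZ)
    refine ⟨h, ?_, rfl⟩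
    -- If `h ∉ M`, some `i ∈ M` has no zero in common with `h`, so `F` would contain the empty set.
    by_contra hn
    obtain ⟨y, i, hi, e⟩ := hM.exists_inv hn
    refine hF.empty_notMem ?_
    convert hF.inter_mem _ hZ _ (hs ⟨i, hi, rfl⟩)
    refine (Set.eq_empty_of_forall_notMem ?_).symm
    rintro x ⟨hx, hix⟩
    have := congrFun (congrArg (Subtype.val) e) x
    simp only [zeroSet, Set.mem_ofPred_eq] at hx hix
    simp [hx, hix] at this

theorem exists_isMaximal_zeroSetsOf_eq {K : Type*} [Field K] {R : Subring (K → K)}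
    {D : Set (Set K)} (hD : ∀ Z, Z ∈ D ↔ ∃ f : R, Z = zeroSet (f : K → K))
    (hi : ∀ Z₁ ∈ D, ∀ Z₂ ∈ D, Z₁ ∩ Z₂ ∈ D)
    (hR : ∀ (I : Ideal R) (f g k : R), f ∈ I → g ∈ I → k ∈ I →
      (∀ x, (f : K → K) x = 0 → (g : K → K) x = 0 → (k : K → K) x ≠ 0) → I = ⊤)
    {F : Set (Set K)} (hF : Maximal (IsDiscreteZFilter D) F) :
    ∃ M : Ideal R, M.IsMaximal ∧ zeroSetsOf M = F := by
  have huD : Set.univ ∈ D := (hD _).2 ⟨0, by ext; simp [zeroSet]⟩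
  -- A filter may be empty by definition, so this membership has to come from maximality.
  have hu : Set.univ ∈ F := by
    have hF' : IsDiscreteZFilter D (insert Set.univ F) := by
      refine ⟨Set.insert_subset huD hF.1.subset, ?_, ?_, ?_⟩
      · rintro (h | h)
        · exact Set.empty_ne_univ h
        · exact hF.1.empty_notMem h
      · rintro Z₁ (rfl | h1) Z₂ (rfl | h2)
        · simp
        · simp [h2]
        · simp [h1]
        · exact Or.inr (hF.1.inter_mem _ h1 _ h2)
      · rintro Z₁ (rfl | h1) Z hZ hs
        · exact Or.inl (Set.univ_subset_iff.1 hs)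
        · exact Or.inr (hF.1.mem_of_superset _ h1 _ hZ hs)
    exact hF.2 hF' (Set.subset_insert _ _) (Set.mem_insert _ _)
  let I : Ideal R :=
    { carrier := {f | zeroSet (f : K → K) ∈ F}
      add_mem' := fun {f g} hf hg =>
        hF.1.mem_of_superset _ (hF.1.inter_mem _ hf _ hg) _ ((hD _).2 ⟨f + g, rfl⟩) (by
          rintro x ⟨h1, h2⟩
          simp only [zeroSet, Set.mem_ofPred_eq] at h1 h2 ⊢
          simp [h1, h2])
      zero_mem' := by
        have : zeroSet ((0 : R) : K → K) = Set.univ := by ext; simp [zeroSet]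
        exact (congrArg (· ∈ F) this).mpr hu
      smul_mem' := fun c f hf =>
        hF.1.mem_of_superset _ hf _ ((hD _).2 ⟨c * f, rfl⟩) (by
          intro x h1
          simp only [zeroSet, Set.mem_ofPred_eq] at h1 ⊢
          simp [h1]) }
  have hIt : I ≠ ⊤ := by
    intro h
    have h1 : (1 : R) ∈ I := h ▸ Submodule.mem_top
    refine hF.1.empty_notMem ?_
    have e : zeroSet ((1 : R) : K → K) = ∅ := by ext; simp [zeroSet]
    exact e ▸ h1
  obtain ⟨M, hM, hIM⟩ := Ideal.exists_le_maximal I hIt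
  -- The zero sets of `M` form a filter containing `F`, hence equal to `F` by maximality.
  refine ⟨M, hM, subset_antisymm (hF.2 (maximal_zeroSetsOf hD hi hR hM).1 ?_) ?_⟩
  all_goals
    intro Z hZ
    obtain ⟨f, rfl⟩ := (hD _).1 (hF.1.subset hZ)
    exact ⟨f, hIM hZ, rfl⟩

theorem exists_homeomorph_zeroSetsOf {K : Type*} [Field K] {R : Subring (K → K)}
    {D : Set (Set K)} (hD : ∀ Z, Z ∈ D ↔ ∃ f : R, Z = zeroSet (f : K → K))
    (hi : ∀ Z₁ ∈ D, ∀ Z₂ ∈ D, Z₁ ∩ Z₂ ∈ D)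
    (hR : ∀ (I : Ideal R) (f g k : R), f ∈ I → g ∈ I → k ∈ I →
      (∀ x, (f : K → K) x = 0 → (g : K → K) x = 0 → (k : K → K) x ≠ 0) → I = ⊤) :
    ∃ ψ : MaximalSpectrum R ≃ₜ DiscreteZUltrafilter D, ∀ M, (ψ M).1 = zeroSetsOf M.asIdeal := by
  let φ : MaximalSpectrum R → DiscreteZUltrafilter D := fun M =>
    ⟨zeroSetsOf M.asIdeal, maximal_zeroSetsOf hD hi hR M.isMaximal⟩
  have mem_iff : ∀ (M : MaximalSpectrum R) (f : R),
      zeroSet (f : K → K) ∈ zeroSetsOf M.asIdeal ↔ f ∈ M.asIdeal := fun M f =>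
    ⟨fun ⟨g, hg, e⟩ => mem_of_zeroSet_inter_subset hR M.isMaximal hg hg
      (Set.inter_subset_left.trans e.symm.subset), fun hf => ⟨f, hf, rfl⟩⟩
  have hbij : Function.Bijective φ := by
    constructor
    · intro M N h
      have h' : zeroSetsOf M.asIdeal = zeroSetsOf N.asIdeal := congrArg Subtype.val h
      ext f
      rw [← mem_iff, ← mem_iff, h']
    · rintro ⟨F, hF⟩
      obtain ⟨M, hM, e⟩ := exists_isMaximal_zeroSetsOf_eq hD hi hR hF
      exact ⟨⟨M, hM⟩, Subtype.ext e⟩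
  have hind : Topology.IsInducing φ := by
    refine ⟨?_⟩
    rw [DiscreteZUltrafilter.instTopologicalSpace, induced_generateFrom_eq,
      MaximalSpectrum.zariskiTopology, PrimeSpectrum.isTopologicalBasis_basic_opens.eq_generateFrom,
      induced_generateFrom_eq]
    congr 1
    have key : ∀ f : R, MaximalSpectrum.toPrimeSpectrum ⁻¹' ↑(PrimeSpectrum.basicOpen f) =
        φ ⁻¹' (basicClosed D (zeroSet (f : K → K)))ᶜ := by
      intro f
      ext M
      exact (not_congr (mem_iff M f)).symm
    ext U
    constructor
    · rintro ⟨_, ⟨f, rfl⟩, rfl⟩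
      exact ⟨_, ⟨_, (hD _).2 ⟨f, rfl⟩, rfl⟩, (key f).symm⟩
    · rintro ⟨_, ⟨Z, hZ, rfl⟩, rfl⟩
      obtain ⟨f, rfl⟩ := (hD _).1 hZ
      exact ⟨_, ⟨f, rfl⟩, key f⟩
  exact ⟨(Equiv.ofBijective φ hbij).toHomeomorphOfIsInducing hind, fun M => rfl⟩

/-! ### Transfer of ultrafilters along a surjection -/

/-- If the members of `D` are the preimages of the members of `D'` under a surjection, then the
spaces of discrete `z`-ultrafilters of `D` and `D'` are homeomorphic. -/
theorem nonempty_homeomorph_of_preimage {X Y : Type*} {π : X → Y} (hπ : π.Surjective)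
    {D : Set (Set X)} {D' : Set (Set Y)} (h : ∀ T, π ⁻¹' T ∈ D ↔ T ∈ D')
    (h' : ∀ S ∈ D, ∃ T, S = π ⁻¹' T) :
    Nonempty (DiscreteZUltrafilter D ≃ₜ DiscreteZUltrafilter D') := by
  have hinj : Function.Injective (Set.preimage π) := hπ.preimage_injective
  have down : ∀ G, IsDiscreteZFilter D G → IsDiscreteZFilter D' (Set.preimage π ⁻¹' G) := by
    intro G hG
    refine ⟨fun T hT => (h T).1 (hG.subset hT), hG.empty_notMem,
      fun T₁ h1 T₂ h2 => hG.inter_mem _ h1 _ h2, fun T₁ h1 T hT hs => ?_⟩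
    exact hG.mem_of_superset _ h1 _ ((h T).2 hT) (Set.preimage_mono hs)
  have up : ∀ F, IsDiscreteZFilter D' F → IsDiscreteZFilter D (Set.preimage π '' F) := by
    intro F hF
    refine ⟨?_, ?_, ?_, ?_⟩
    · rintro _ ⟨T, hT, rfl⟩
      exact (h T).2 (hF.subset hT)
    · rintro ⟨T, hT, e⟩
      rw [← Set.preimage_empty (f := π)] at e
      exact hF.empty_notMem (hinj e ▸ hT)
    · rintro _ ⟨T₁, h1, rfl⟩ _ ⟨T₂, h2, rfl⟩
      exact ⟨_, hF.inter_mem _ h1 _ h2, rfl⟩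
    · rintro _ ⟨T₁, h1, rfl⟩ Z hZ hs
      obtain ⟨T, rfl⟩ := h' Z hZ
      exact ⟨T, hF.mem_of_superset _ h1 _ ((h T).1 hZ) ((hπ.preimage_subset_preimage_iff).1 hs), rfl⟩
  have du : ∀ F, Set.preimage π ⁻¹' (Set.preimage π '' F) = F := fun F =>
    Set.preimage_image_eq F hinj
  have ud : ∀ G, IsDiscreteZFilter D G → Set.preimage π '' (Set.preimage π ⁻¹' G) = G := by
    intro G hG
    refine Set.image_preimage_eq_of_subset fun S hS => ?_
    obtain ⟨T, rfl⟩ := h' S (hG.subset hS)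
    exact ⟨T, rfl⟩
  let e : DiscreteZUltrafilter D ≃ DiscreteZUltrafilter D' :=
    { toFun := fun p => ⟨Set.preimage π ⁻¹' p.1, down _ p.2.1, fun F hF hs => by
        rw [← du F]
        refine Set.preimage_mono (p.2.2 (up F hF) ?_)
        rw [← ud p.1 p.2.1]
        exact Set.image_mono hs⟩
      invFun := fun q => ⟨Set.preimage π '' q.1, up _ q.2.1, fun G hG hs => by
        rw [← ud G hG]
        refine Set.image_mono (q.2.2 (down G hG) ?_)
        rw [← du q.1]
        exact Set.preimage_mono hs⟩
      left_inv := fun p => Subtype.ext (ud p.1 p.2.1)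
      right_inv := fun q => Subtype.ext (du q.1) }
  refine ⟨e.toHomeomorphOfIsInducing ⟨?_⟩⟩
  rw [DiscreteZUltrafilter.instTopologicalSpace, DiscreteZUltrafilter.instTopologicalSpace,
    induced_generateFrom_eq]
  congr 1
  ext U
  constructor
  · rintro ⟨S, hS, rfl⟩
    obtain ⟨T, rfl⟩ := h' S hS
    exact ⟨_, ⟨T, (h T).1 hS, rfl⟩, rfl⟩
  · rintro ⟨_, ⟨T, hT, rfl⟩, rfl⟩
    exact ⟨_, (h T).2 hT, rfl⟩

/-! ### Approximation and limits of entire functions -/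

theorem exists_differentiable_near_of_ball {h : ℂ → ℂ} {r R ε : ℝ}
    (hh : DifferentiableOn ℂ h (Metric.ball 0 R)) (hr : r < R) (hε : 0 < ε) :
    ∃ p : ℂ → ℂ, Differentiable ℂ p ∧ ∀ z ∈ Metric.ball (0 : ℂ) r, ‖h z - p z‖ < ε := by
  rcases le_or_gt r 0 with h0 | h0
  · refine ⟨0, differentiable_const 0, fun z hz => ?_⟩
    rw [Metric.ball_eq_empty.2 h0] at hz
    exact hz.elim
  obtain ⟨s, hrs, hsR⟩ := exists_between hr
  lift s to NNReal using (h0.trans hrs).le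
  lift r to NNReal using h0.le
  have hp := (hh.mono (Metric.closedBall_subset_ball hsR)).hasFPowerSeriesOnBall
    (NNReal.coe_pos.1 (h0.trans hrs))
  have ht := hp.tendstoUniformlyOn' (r' := r) (by exact_mod_cast hrs)
  rw [Metric.tendstoUniformlyOn_iff] at ht
  obtain ⟨n, hn⟩ := (ht ε hε).exists
  refine ⟨fun y => (cauchyPowerSeries h 0 s).partialSum n (y - 0), ?_, fun z hz => ?_⟩
  · intro y
    unfold FormalMultilinearSeries.partialSum
    simp only [FormalMultilinearSeries.apply_eq_pow_smul_coeff]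
    fun_prop
  · simpa [dist_eq_norm] using hn z hz

theorem exists_differentiable_limit {U : ℕ → ℂ → ℂ}
    (hU : ∀ n, DifferentiableOn ℂ (U n) (Metric.ball 0 (n + 1)))
    (hd : ∀ n : ℕ, ∀ z ∈ Metric.ball (0 : ℂ) n, ‖U (n + 1) z - U n z‖ ≤ (1 / 2 : ℝ) ^ n) :
    ∃ f : ℂ → ℂ, Differentiable ℂ f ∧
      ∀ z, Filter.Tendsto (fun n => U n z) Filter.atTop (nhds (f z)) := by
  have hs : ∀ m : ℕ, Summable fun k : ℕ => (1 / 2 : ℝ) ^ (m + k) := fun m => by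
    simp_rw [pow_add]
    exact summable_geometric_two.mul_left _
  let f : ℕ → ℂ → ℂ := fun m z => U m z + ∑' k, (U (m + k + 1) z - U (m + k) z)
  have hb : ∀ (m k : ℕ), ∀ z ∈ Metric.ball (0 : ℂ) m,
      ‖U (m + k + 1) z - U (m + k) z‖ ≤ (1 / 2 : ℝ) ^ (m + k) := fun m k z hz =>
    hd (m + k) z (Metric.ball_subset_ball (by push_cast; linarith [k.cast_nonneg (α := ℝ)]) hz)
  have hlim : ∀ (m : ℕ), ∀ z ∈ Metric.ball (0 : ℂ) m,
      Filter.Tendsto (fun n => U n z) Filter.atTop (nhds (f m z)) := by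
    intro m z hz
    have h1 : Summable fun k => U (m + k + 1) z - U (m + k) z :=
      Summable.of_norm_bounded (hs m) fun k => hb m k z hz
    have h2 := h1.hasSum.tendsto_sum_nat
    have e : ∀ n, ∑ k ∈ Finset.range n, (U (m + k + 1) z - U (m + k) z) = U (m + n) z - U m z :=
      fun n => by
        have := Finset.sum_range_sub (fun k => U (m + k) z) n
        simpa [add_assoc] using this
    simp_rw [e] at h2
    have h3 := h2.const_add (U m z)
    simp only [add_sub_cancel] at h3
    exact (Filter.tendsto_add_atTop_iff_nat m).1 (h3.congr fun n => by rw [add_comm])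
  have hdiff : ∀ m, DifferentiableOn ℂ (f m) (Metric.ball 0 m) := by
    intro m
    refine ((hU m).mono (Metric.ball_subset_ball (by linarith))).add
      (Complex.differentiableOn_tsum_of_summable_norm (hs m) (fun k => ?_) Metric.isOpen_ball
        fun k z hz => hb m k z hz)
    refine DifferentiableOn.sub ((hU _).mono (Metric.ball_subset_ball ?_))
      ((hU _).mono (Metric.ball_subset_ball ?_)) <;> push_cast <;>
      linarith [k.cast_nonneg (α := ℝ)]
  have hmem : ∀ z : ℂ, z ∈ Metric.ball (0 : ℂ) ((⌊‖z‖⌋₊ + 1 : ℕ) : ℝ) := fun z => by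
    simpa using Nat.lt_floor_add_one ‖z‖
  -- The `f m` agree on common balls, being limits of the same sequence, so the index may vary with
  -- `z` without spoiling differentiability.
  refine ⟨fun z => f (⌊‖z‖⌋₊ + 1) z, fun z => ?_, fun z => hlim _ z (hmem z)⟩
  refine ((hdiff (⌊‖z‖⌋₊ + 1)).differentiableAt
    (Metric.isOpen_ball.mem_nhds (hmem z))).congr_of_eventuallyEq ?_
  filter_upwards [Metric.isOpen_ball.mem_nhds (hmem z)] with w hw
  exact tendsto_nhds_unique (hlim _ w (hmem w)) (hlim _ w hw)

/-! ### Zeros and the Bézout identity for entire functions -/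

theorem zeroSet_mem_closedDiscreteSets {𝕜 : Type*} [NontriviallyNormedField 𝕜] [ConnectedSpace 𝕜]
    {f : 𝕜 → 𝕜} (hf : AnalyticOnNhd 𝕜 f Set.univ) : zeroSet f ∈ closedDiscreteSets 𝕜 := by
  by_cases h : ∃ x, f x ≠ 0
  · obtain ⟨x, hx⟩ := h
    have := mem_codiscrete'.1 (hf.preimage_zero_mem_codiscrete hx)
    have e : (f ⁻¹' {0}ᶜ)ᶜ = zeroSet f := by ext; simp [zeroSet]
    exact Or.inl ⟨e ▸ this.1.isClosed_compl, e ▸ this.2⟩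
  · push Not at h
    exact Or.inr (Set.eq_univ_of_forall h)

theorem exists_eq_pow_mul {f : ℂ → ℂ} (hf : Differentiable ℂ f) (h0 : ∃ z, f z ≠ 0) (a : ℂ) :
    ∃ (m : ℕ) (g : ℂ → ℂ), Differentiable ℂ g ∧ g a ≠ 0 ∧ ∀ z, f z = (z - a) ^ m * g z := by
  obtain ⟨z₀, hz₀⟩ := h0
  have hne : analyticOrderAt f a ≠ ⊤ := by
    intro ht
    rw [analyticOrderAt_eq_top] at ht
    have := AnalyticOnNhd.eqOn_zero_of_preconnected_of_eventuallyEq_zero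
      (fun z _ => hf.analyticAt z) isPreconnected_univ (Set.mem_univ a) ht
    exact hz₀ (this (Set.mem_univ z₀))
  obtain ⟨g, hg, hga, he⟩ := (hf.analyticAt a).analyticOrderAt_ne_top.1 hne
  set m := analyticOrderNatAt f a
  let G : ℂ → ℂ := Function.update (fun z => f z / (z - a) ^ m) a (g a)
  have hGz : ∀ z, z ≠ a → G z = f z / (z - a) ^ m := fun z hz => Function.update_of_ne hz _ _
  have hGa : G a = g a := Function.update_self _ _ _
  have hGe : G =ᶠ[nhds a] g := by
    filter_upwards [he] with z hz
    by_cases h : z = a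
    · rw [h, hGa]
    · rw [hGz z h, hz, smul_eq_mul, mul_div_cancel_left₀ _ (pow_ne_zero _ (sub_ne_zero.2 h))]
  refine ⟨m, G, fun z => ?_, by rwa [hGa], fun z => ?_⟩
  · by_cases h : z = a
    · subst h
      exact hg.differentiableAt.congr_of_eventuallyEq hGe
    · have : DifferentiableAt ℂ (fun z => f z / (z - a) ^ m) z :=
        (hf z).div (by fun_prop) (pow_ne_zero _ (sub_ne_zero.2 h))
      refine this.congr_of_eventuallyEq ?_
      filter_upwards [isOpen_ne.mem_nhds h] with w hw using hGz w hw
  · by_cases h : z = a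
    · subst h
      rw [hGa]
      exact he.self_of_nhds
    · rw [hGz z h, mul_div_cancel₀ _ (pow_ne_zero _ (sub_ne_zero.2 h))]

/-- Dividing out one zero with its full multiplicity lowers the finite number of distinct zeros in
the closed ball. -/
theorem exists_eq_polynomial_mul {f : ℂ → ℂ} (hf : Differentiable ℂ f) (h0 : ∃ z, f z ≠ 0)
    (R : ℝ) : ∃ (P : Polynomial ℂ) (g : ℂ → ℂ), Differentiable ℂ g ∧
      (∀ z, f z = P.eval z * g z) ∧ ∀ z ∈ Metric.closedBall (0 : ℂ) R, g z ≠ 0 := by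
  have hfin : (zeroSet f ∩ Metric.closedBall 0 R).Finite := by
    rcases zeroSet_mem_closedDiscreteSets (fun z _ => hf.analyticAt z) with h | h
    · exact ((isCompact_closedBall 0 R).inter_left h.1).finite (h.2.mono Set.inter_subset_left)
    · obtain ⟨z, hz⟩ := h0
      exact (hz (h ▸ Set.mem_univ z : z ∈ zeroSet f)).elim
  induction hn : (zeroSet f ∩ Metric.closedBall 0 R).ncard using Nat.strong_induction_on
    generalizing f with
  | _ n ih =>
    by_cases hz : ∃ a, a ∈ zeroSet f ∩ Metric.closedBall 0 R
    · obtain ⟨a, ha⟩ := hz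
      obtain ⟨m, g, hg, hga, e⟩ := exists_eq_pow_mul hf h0 a
      have hsub : zeroSet g ∩ Metric.closedBall 0 R ⊂ zeroSet f ∩ Metric.closedBall 0 R := by
        refine ⟨Set.inter_subset_inter_left _ fun z hz => ?_, fun h => hga (h ha).1⟩
        have hz' : g z = 0 := hz
        simp [zeroSet, e, hz']
      obtain ⟨P, k, hk, e', hk'⟩ := ih _ (hn ▸ Set.ncard_lt_ncard hsub hfin) hg ⟨a, hga⟩
        (hfin.subset hsub.1) rfl
      refine ⟨(Polynomial.X - Polynomial.C a) ^ m * P, k, hk, fun z => ?_, hk'⟩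
      rw [e, e']
      simp [mul_assoc]
    · push Not at hz
      exact ⟨1, f, hf, by simp, fun z hz' h => hz z ⟨h, hz'⟩⟩

/-- Polynomials carry the zeros in the ball; they are coprime, and their Bézout coefficients are
divided by the zero-free cofactors. -/
theorem exists_bezout_on_ball {f g : ℂ → ℂ} (hf : Differentiable ℂ f) (hg : Differentiable ℂ g)
    (hfg : ∀ z, f z = 0 → g z ≠ 0) (R : ℝ) : ∃ u v : ℂ → ℂ,
      DifferentiableOn ℂ u (Metric.ball 0 R) ∧ DifferentiableOn ℂ v (Metric.ball 0 R) ∧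
      ∀ z ∈ Metric.ball (0 : ℂ) R, u z * f z + v z * g z = 1 := by
  by_cases hf0 : ∃ z, f z ≠ 0
  swap
  · push Not at hf0
    refine ⟨0, fun z => (g z)⁻¹, differentiableOn_const 0,
      (hg.inv fun z => hfg z (hf0 z)).differentiableOn, fun z _ => ?_⟩
    simp [hfg z (hf0 z)]
  by_cases hg0 : ∃ z, g z ≠ 0
  swap
  · push Not at hg0
    have h : ∀ z, f z ≠ 0 := fun z hz => hfg z hz (hg0 z)
    refine ⟨fun z => (f z)⁻¹, 0, (hf.inv h).differentiableOn, differentiableOn_const 0,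
      fun z _ => ?_⟩
    simp [h z]
  obtain ⟨P, F, hF, e1, hF0⟩ := exists_eq_polynomial_mul hf hf0 R
  obtain ⟨Q, G, hG, e2, hG0⟩ := exists_eq_polynomial_mul hg hg0 R
  obtain ⟨a, b, hab⟩ : IsCoprime P Q := by
    rw [Polynomial.isCoprime_iff_aeval_ne_zero_of_isAlgClosed ℂ ℂ]
    intro z
    by_contra! h
    simp only [Polynomial.coe_aeval_eq_eval] at h
    exact hfg z (by rw [e1, h.1, zero_mul]) (by rw [e2, h.2, zero_mul])
  have hsub := Metric.ball_subset_closedBall (x := (0 : ℂ)) (ε := R)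
  refine ⟨fun z => a.eval z / F z, fun z => b.eval z / G z,
    a.differentiable.differentiableOn.div hF.differentiableOn fun z hz => hF0 z (hsub hz),
    b.differentiable.differentiableOn.div hG.differentiableOn fun z hz => hG0 z (hsub hz),
    fun z hz => ?_⟩
  have h := congrArg (Polynomial.eval z) hab
  simp only [Polynomial.eval_add, Polynomial.eval_mul, Polynomial.eval_one] at h
  have h1 := hF0 z (hsub hz)
  have h2 := hG0 z (hsub hz)
  rw [e1, e2, ← h]
  field_simp

/-- Local solutions are glued by a Mittag-Leffler argument: adding `(-p * g, p * f)` to a solution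
gives another one, and this freedom makes each solution close to the preceding one. -/
theorem exists_bezout {f g : ℂ → ℂ} (hf : Differentiable ℂ f) (hg : Differentiable ℂ g)
    (hfg : ∀ z, f z = 0 → g z ≠ 0) : ∃ u v : ℂ → ℂ,
      Differentiable ℂ u ∧ Differentiable ℂ v ∧ ∀ z, u z * f z + v z * g z = 1 := by
  let S : ℕ → Type := fun n => {p : (ℂ → ℂ) × (ℂ → ℂ) //
    DifferentiableOn ℂ p.1 (Metric.ball 0 (n + 1)) ∧
    DifferentiableOn ℂ p.2 (Metric.ball 0 (n + 1)) ∧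
    ∀ z ∈ Metric.ball (0 : ℂ) (n + 1), p.1 z * f z + p.2 z * g z = 1}
  have step : ∀ (n : ℕ) (p : S n), ∃ q : S (n + 1), ∀ z ∈ Metric.ball (0 : ℂ) n,
      ‖q.1.1 z - p.1.1 z‖ ≤ (1 / 2 : ℝ) ^ n ∧ ‖q.1.2 z - p.1.2 z‖ ≤ (1 / 2 : ℝ) ^ n := by
    rintro n ⟨⟨U, V⟩, hU, hV, hUV⟩
    obtain ⟨u, v, hu, hv, huv⟩ := exists_bezout_on_ball hf hg hfg ((n + 1 : ℕ) + 1)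
    obtain ⟨Cf, hCf⟩ := (isCompact_closedBall (0 : ℂ) n).exists_bound_of_continuousOn
      hf.continuous.continuousOn
    obtain ⟨Cg, hCg⟩ := (isCompact_closedBall (0 : ℂ) n).exists_bound_of_continuousOn
      hg.continuous.continuousOn
    set C := max 1 (max Cf Cg)
    have hC : 0 < C := lt_of_lt_of_le one_pos (le_max_left _ _)
    have hbb : Metric.ball (0 : ℂ) (n + 1) ⊆ Metric.ball 0 ((n + 1 : ℕ) + 1) :=
      Metric.ball_subset_ball (by push_cast; linarith)
    -- With `w = u * V - U * v` one has `u - U = w * g` and `v - V = -w * f`, so `p = w` would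
    -- recover `(U, V)` exactly. An entire `p` near `w` also keeps the new pair defined on the
    -- larger ball.
    obtain ⟨p, hp, hpw⟩ := exists_differentiable_near_of_ball
      (h := fun z => u z * V z - U z * v z) (r := n) (R := n + 1) (ε := (1 / 2 : ℝ) ^ n / C)
      (((hu.mono hbb).mul hV).sub (hU.mul (hv.mono hbb))) (by linarith) (by positivity)
    refine ⟨⟨⟨fun z => u z - p z * g z, fun z => v z + p z * f z⟩,
      hu.sub (hp.mul hg).differentiableOn, hv.add (hp.mul hf).differentiableOn,
      fun z hz => ?_⟩, fun z hz => ?_⟩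
    · simp only
      linear_combination huv z hz
    · have hz1 : z ∈ Metric.ball (0 : ℂ) (n + 1) := Metric.ball_subset_ball (by linarith) hz
      have e1 := hUV z hz1
      have e2 := huv z (hbb hz1)
      simp only at e1
      have hz' := Metric.ball_subset_closedBall hz
      have hf' : ‖f z‖ ≤ C := (hCf z hz').trans ((le_max_left _ _).trans (le_max_right _ _))
      have hg' : ‖g z‖ ≤ C := (hCg z hz').trans ((le_max_right _ _).trans (le_max_right _ _))
      have hw := (hpw z hz).le
      have hfin : (1 / 2 : ℝ) ^ n / C * C = (1 / 2 : ℝ) ^ n := div_mul_cancel₀ _ hC.ne'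
      constructor
      · have : u z - p z * g z - U z = (u z * V z - U z * v z - p z) * g z := by
          linear_combination -u z * e1 + U z * e2
        simp only [this, norm_mul]
        rw [← hfin]
        gcongr
      · have : v z + p z * f z - V z = -((u z * V z - U z * v z - p z) * f z) := by
          linear_combination -v z * e1 + V z * e2
        simp only [this, norm_neg, norm_mul]
        rw [← hfin]
        gcongr
  choose next hnext using step
  obtain ⟨u₀, v₀, h₀⟩ := exists_bezout_on_ball hf hg hfg ((0 : ℕ) + 1)
  let s : ∀ n, S n := fun n => Nat.rec ⟨(u₀, v₀), h₀⟩ next n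
  obtain ⟨u, hu, hul⟩ := exists_differentiable_limit (U := fun n => (s n).1.1)
    (fun n => (s n).2.1) fun n z hz => (hnext n (s n) z hz).1
  obtain ⟨v, hv, hvl⟩ := exists_differentiable_limit (U := fun n => (s n).1.2)
    (fun n => (s n).2.2.1) fun n z hz => (hnext n (s n) z hz).2
  refine ⟨u, v, hu, hv, fun z => ?_⟩
  refine tendsto_nhds_unique (((hul z).mul_const (f z)).add ((hvl z).mul_const (g z))) ?_
  refine tendsto_const_nhds.congr' ?_
  filter_upwards [Filter.eventually_ge_atTop ⌊‖z‖⌋₊] with n hn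
  refine ((s n).2.2.2 z ?_).symm
  have : (⌊‖z‖⌋₊ : ℝ) ≤ n := by exact_mod_cast hn
  simpa using (Nat.lt_floor_add_one ‖z‖).trans_le (by linarith)

/-! ### Entire functions with prescribed zeros -/

/-- On the ball of radius `n` the product of the `1 - z / a` has a holomorphic logarithm;
multiplying by `exp (-p)`, with `p` entire and close to that logarithm, brings it near 1. These are
the factors of a Weierstrass product. -/
theorem exists_differentiable_zeros_near_one (n : ℕ) (S : Finset ℂ) (hS : ∀ a ∈ S, (n : ℝ) ≤ ‖a‖)
    {ε : ℝ} (hε : 0 < ε) : ∃ G : ℂ → ℂ, Differentiable ℂ G ∧ (∀ z, G z = 0 ↔ z ∈ S) ∧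
      ∀ z ∈ Metric.ball (0 : ℂ) (n - 1), ‖G z - 1‖ ≤ ε := by
  rcases Nat.eq_zero_or_pos n with rfl | hn
  -- Here `S` may contain 0, but the ball has radius `-1`, so no estimate is needed.
  · refine ⟨fun z => ∏ a ∈ S, (z - a), by fun_prop, fun z => ?_, fun z hz => ?_⟩
    · simp [Finset.prod_eq_zero_iff, sub_eq_zero]
    · rw [Metric.ball_eq_empty.2 (by simp)] at hz
      exact hz.elim
  have hn' : (0 : ℝ) < n := by exact_mod_cast hn
  have hS0 : ∀ a ∈ S, a ≠ 0 := fun a ha => norm_pos_iff.1 (hn'.trans_le (hS a ha))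
  have hslit : ∀ a ∈ S, ∀ z ∈ Metric.ball (0 : ℂ) n, 1 - z / a ∈ Complex.slitPlane := by
    intro a ha z hz
    rw [sub_eq_add_neg]
    refine Complex.mem_slitPlane_of_norm_lt_one ?_
    rw [norm_neg, norm_div, div_lt_one (norm_pos_iff.2 (hS0 a ha))]
    exact (mem_ball_zero_iff.1 hz).trans_le (hS a ha)
  obtain ⟨p, hp, hpw⟩ := exists_differentiable_near_of_ball
    (h := fun z => ∑ a ∈ S, Complex.log (1 - z / a)) (r := n - 1) (R := n) (ε := min 1 (ε / 2))
    (by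
      refine DifferentiableOn.fun_sum fun a ha z hz => ?_
      refine DifferentiableAt.differentiableWithinAt ?_
      exact DifferentiableAt.clog (by fun_prop) (hslit a ha z hz)) (by linarith) (by positivity)
  refine ⟨fun z => (∏ a ∈ S, (1 - z / a)) * Complex.exp (-p z), by fun_prop, fun z => ?_,
    fun z hz => ?_⟩
  · simp only [mul_eq_zero, Complex.exp_ne_zero, or_false, Finset.prod_eq_zero_iff]
    constructor
    · rintro ⟨a, ha, h⟩
      rw [sub_eq_zero, eq_div_iff (hS0 a ha), one_mul] at h
      exact h ▸ ha
    · exact fun h => ⟨z, h, by rw [div_self (hS0 z h), sub_self]⟩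
  · have hb : z ∈ Metric.ball (0 : ℂ) n := Metric.ball_subset_ball (by linarith) hz
    have e : ∏ a ∈ S, (1 - z / a) = Complex.exp (∑ a ∈ S, Complex.log (1 - z / a)) := by
      rw [Complex.exp_sum]
      exact Finset.prod_congr rfl fun a ha =>
        (Complex.exp_log (Complex.slitPlane_ne_zero (hslit a ha z hb))).symm
    have h1 := hpw z hz
    simp only
    rw [e, ← Complex.exp_add, ← sub_eq_add_neg]
    -- `|exp w - 1| ≤ 2|w|` for `|w| ≤ 1`, whence the tolerance `min 1 (ε / 2)`.
    refine (Complex.norm_exp_sub_one_le (h1.le.trans (min_le_left _ _))).trans ?_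
    linarith [min_le_right 1 (ε / 2)]

theorem isClosed_and_isDiscrete_iff_finite {Z : Set ℂ} :
    (IsClosed Z ∧ IsDiscrete Z) ↔ ∀ n : ℕ, (Z ∩ {z | ⌊‖z‖⌋₊ = n}).Finite := by
  constructor
  · rintro ⟨h1, h2⟩ n
    refine (((isCompact_closedBall (0 : ℂ) (n + 1)).inter_left h1).finite
      (h2.mono Set.inter_subset_left)).subset ?_
    rintro z ⟨hz, rfl⟩
    exact ⟨hz, by simpa using (Nat.lt_floor_add_one ‖z‖).le⟩
  · intro h
    rw [isClosed_and_discrete_iff]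
    intro x
    rw [Filter.disjoint_principal_right]
    set m := ⌊‖x‖⌋₊ + 1
    have hfin : (⋃ n ∈ Finset.range m, Z ∩ {z | ⌊‖z‖⌋₊ = n}).Finite :=
      Set.Finite.biUnion (Finset.finite_toSet _) fun n _ => h n
    refine mem_nhdsWithin.2 ⟨Metric.ball 0 m ∩
      ((⋃ n ∈ Finset.range m, Z ∩ {z | ⌊‖z‖⌋₊ = n}) \ {x})ᶜ,
      Metric.isOpen_ball.inter (hfin.sdiff).isClosed.isOpen_compl, ⟨?_, by simp⟩, ?_⟩
    · simpa [m] using Nat.lt_floor_add_one ‖x‖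
    · rintro z ⟨⟨hz1, hz2⟩, hzx⟩ hz
      refine hz2 ⟨?_, hzx⟩
      simp only [Set.mem_iUnion]
      refine ⟨⌊‖z‖⌋₊, ?_, hz, rfl⟩
      rw [Finset.mem_range, Nat.floor_lt (norm_nonneg z)]
      exact mem_ball_zero_iff.1 hz1

/-- One factor per annulus: since `G n` is within `2⁻ⁿ` of 1 on the ball of radius `n - 1`, the
product converges locally uniformly and vanishes only where a factor does. -/
theorem exists_differentiable_zeroSet_eq {Z : Set ℂ} (hc : IsClosed Z) (hd : IsDiscrete Z) :
    ∃ f : ℂ → ℂ, Differentiable ℂ f ∧ ∀ z, f z = 0 ↔ z ∈ Z := by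
  have hfin := isClosed_and_isDiscrete_iff_finite.1 ⟨hc, hd⟩
  have hex : ∀ n : ℕ, ∃ G : ℂ → ℂ, Differentiable ℂ G ∧
      (∀ z, G z = 0 ↔ z ∈ Z ∧ ⌊‖z‖⌋₊ = n) ∧
      ∀ z ∈ Metric.ball (0 : ℂ) (n - 1), ‖G z - 1‖ ≤ (1 / 2 : ℝ) ^ n := by
    intro n
    obtain ⟨G, h1, h2, h3⟩ := exists_differentiable_zeros_near_one n (hfin n).toFinset
      (fun a ha => by
        have := ((hfin n).mem_toFinset.1 ha).2
        simp only [Set.mem_ofPred_eq] at this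
        exact this ▸ Nat.floor_le (norm_nonneg a)) (ε := (1 / 2 : ℝ) ^ n) (by positivity)
    exact ⟨G, h1, fun z => by simp [h2], h3⟩
  choose G hG hG0 hG1 using hex
  have hb : ∀ (R : ℝ), ∀ᶠ n : ℕ in Filter.atTop, ∀ z ∈ Metric.ball (0 : ℂ) R,
      ‖G n z - 1‖ ≤ (1 / 2 : ℝ) ^ n := by
    intro R
    filter_upwards [Filter.eventually_ge_atTop ⌈R + 1⌉₊] with n hn z hz
    refine hG1 n z (Metric.ball_subset_ball ?_ hz)
    linarith [Nat.ceil_le.1 hn]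
  refine ⟨fun z => ∏' n, (1 + (G n z - 1)), fun z => ?_, fun z => ?_⟩
  · have hz : z ∈ Metric.ball (0 : ℂ) (‖z‖ + 1) := by simp
    have hprod := Summable.hasProdLocallyUniformlyOn_nat_one_add (f := fun n z => G n z - 1)
      (Metric.isOpen_ball (x := (0 : ℂ)) (ε := ‖z‖ + 1)) summable_geometric_two (hb _)
      (fun n => ((hG n).sub_const 1).continuous.continuousOn)
    rw [hasProdLocallyUniformlyOn_iff_tendstoLocallyUniformlyOn] at hprod
    refine (hprod.differentiableOn (Filter.Eventually.of_forall fun s => ?_)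
      Metric.isOpen_ball).differentiableAt (Metric.isOpen_ball.mem_nhds hz)
    have : Differentiable ℂ fun z => ∏ i ∈ s, (1 + (G i z - 1)) := by fun_prop
    exact this.differentiableOn
  · constructor
    · intro h
      by_contra hz
      refine tprod_one_add_ne_zero_of_summable (f := fun n => G n z - 1) (fun n => ?_) ?_ h
      · rw [add_sub_cancel]
        exact fun h => hz ((hG0 n z).1 h).1
      · refine Summable.of_norm_bounded_eventually_nat summable_geometric_two ?_
        filter_upwards [hb (‖z‖ + 1)] with n hn
        simpa using hn z (by simp)
    · intro hz
      exact tprod_of_exists_eq_zero ⟨⌊‖z‖⌋₊, by rw [add_sub_cancel]; exact (hG0 _ z).2 ⟨hz, rfl⟩⟩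

/-! ### The three rings -/

theorem inter_mem_closedDiscreteSets {X : Type*} [TopologicalSpace X] {Z₁ Z₂ : Set X}
    (h₁ : Z₁ ∈ closedDiscreteSets X) (h₂ : Z₂ ∈ closedDiscreteSets X) :
    Z₁ ∩ Z₂ ∈ closedDiscreteSets X := by
  rcases h₁ with h₁ | rfl
  · rcases h₂ with h₂ | rfl
    · exact Or.inl ⟨h₁.1.inter h₂.1, h₁.2.mono Set.inter_subset_left⟩
    · rw [Set.inter_univ]
      exact Or.inl h₁
  · rwa [Set.univ_inter]

/-- Three functions reduce to two: for a suitable constant `t`, `f + t * g` has no zero in common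
with `k`. -/
theorem ideal_eq_top_of_no_common_zero {R : Subring (ℂ → ℂ)}
    (hc : ∀ t : ℝ, (fun _ => (t : ℂ)) ∈ R) (hd : ∀ f ∈ R, Differentiable ℂ f)
    (hb : ∀ f g : R, (∀ z, (f : ℂ → ℂ) z = 0 → (g : ℂ → ℂ) z ≠ 0) →
      ∃ u v : R, u * f + v * g = 1)
    (I : Ideal R) (f g k : R) (hf : f ∈ I) (hg : g ∈ I) (hk : k ∈ I)
    (hz : ∀ z, (f : ℂ → ℂ) z = 0 → (g : ℂ → ℂ) z = 0 → (k : ℂ → ℂ) z ≠ 0) : I = ⊤ := by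
  have top_of_two : ∀ f g : R, f ∈ I → g ∈ I →
      (∀ z, (f : ℂ → ℂ) z = 0 → (g : ℂ → ℂ) z ≠ 0) → I = ⊤ := by
    intro f g hf hg h
    obtain ⟨u, v, e⟩ := hb f g h
    exact (Ideal.eq_top_iff_one I).2 (e ▸ I.add_mem (I.mul_mem_left u hf) (I.mul_mem_left v hg))
  rcases zeroSet_mem_closedDiscreteSets (f := (k : ℂ → ℂ))
    (fun z _ => (hd k k.2).analyticAt z) with h | h
  · have : DiscreteTopology (zeroSet (k : ℂ → ℂ)) := h.2.to_subtype
    have hcount : (zeroSet (k : ℂ → ℂ)).Countable := by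
      have : Countable (zeroSet (k : ℂ → ℂ)) := countable_of_Lindelof_of_discrete
      exact Set.to_countable _
    obtain ⟨t, ht⟩ := ((hcount.image
      fun z => (-((f : ℂ → ℂ) z / (g : ℂ → ℂ) z)).re).dense_compl ℝ).nonempty
    refine top_of_two (f + ⟨_, hc t⟩ * g) k (I.add_mem hf (I.mul_mem_left _ hg)) hk
      fun z h1 h2 => ?_
    have h1' : (f : ℂ → ℂ) z + t * (g : ℂ → ℂ) z = 0 := h1
    by_cases hgz : (g : ℂ → ℂ) z = 0
    · rw [hgz, mul_zero, add_zero] at h1'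
      exact hz z h1' hgz h2
    · refine ht ⟨z, h2, ?_⟩
      have : -((f : ℂ → ℂ) z / (g : ℂ → ℂ) z) = t := by
        rw [eq_neg_of_add_eq_zero_left h1', neg_div, neg_neg, mul_div_cancel_right₀ _ hgz]
      simp only [this, Complex.ofReal_re]
  · exact top_of_two f g hf hg fun z h1 h2 => hz z h1 h2
      (h ▸ Set.mem_univ z : z ∈ zeroSet (k : ℂ → ℂ))

theorem entireFunctions_zeroSet_iff (Z : Set ℂ) :
    Z ∈ closedDiscreteSets ℂ ↔ ∃ f : entireFunctions, Z = zeroSet (f : ℂ → ℂ) := by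
  constructor
  · rintro (⟨h1, h2⟩ | rfl)
    · obtain ⟨f, hf, e⟩ := exists_differentiable_zeroSet_eq h1 h2
      exact ⟨⟨f, hf⟩, by ext z; exact (e z).symm⟩
    · exact ⟨0, by ext; simp [zeroSet]⟩
  · rintro ⟨f, rfl⟩
    exact zeroSet_mem_closedDiscreteSets fun z _ => Differentiable.analyticAt f.2 z

theorem exists_homeomorph_entireFunctions : ∃ ψ : MaximalSpectrum entireFunctions ≃ₜ Theta ℂ,
    ∀ M, (ψ M).1 = zeroSetsOf M.asIdeal := by
  refine exists_homeomorph_zeroSetsOf entireFunctions_zeroSet_iff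
    (fun _ h1 _ h2 => inter_mem_closedDiscreteSets h1 h2)
    (ideal_eq_top_of_no_common_zero (fun t => differentiable_const _) (fun f hf => hf) ?_)
  intro f g h
  obtain ⟨u, v, hu, hv, e⟩ := exists_bezout f.2 g.2 h
  exact ⟨⟨u, hu⟩, ⟨v, hv⟩, Subtype.ext (funext e)⟩

theorem realAnalyticFunctions_zeroSet_iff (Z : Set ℝ) :
    Z ∈ closedDiscreteSets ℝ ↔ ∃ f : realAnalyticFunctions, Z = zeroSet (f : ℝ → ℝ) := by
  constructor
  · rintro (⟨h1, h2⟩ | rfl)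
    · have hemb := Complex.isometry_ofReal.isClosedEmbedding
      obtain ⟨f, hf, e⟩ := exists_differentiable_zeroSet_eq (hemb.isClosedMap _ h1)
        (h2.image hemb.isInducing)
      have ha : ∀ x : ℝ, AnalyticAt ℝ (fun x : ℝ => f x) x := fun x =>
        AnalyticAt.comp (g := f) (f := fun x : ℝ => (x : ℂ))
          ((hf.analyticAt x).restrictScalars) (Complex.ofRealCLM.analyticAt x)
      have hre : ∀ x : ℝ, AnalyticAt ℝ (fun x : ℝ => (f x).re) x := fun x =>
        AnalyticAt.comp (g := Complex.re) (Complex.reCLM.analyticAt _) (ha x)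
      have him : ∀ x : ℝ, AnalyticAt ℝ (fun x : ℝ => (f x).im) x := fun x =>
        AnalyticAt.comp (g := Complex.im) (Complex.imCLM.analyticAt _) (ha x)
      refine ⟨⟨fun x => (f x).re * (f x).re + (f x).im * (f x).im, fun x =>
        ((hre x).mul (hre x)).add ((him x).mul (him x))⟩, ?_⟩
      ext x
      have hx : x ∈ Z ↔ f x = 0 := by
        rw [e, Function.Injective.mem_set_image Complex.ofReal_injective]
      rw [hx, ← Complex.normSq_eq_zero, Complex.normSq_apply]
      rfl
    · exact ⟨0, by ext; simp [zeroSet]⟩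
  · rintro ⟨f, rfl⟩
    exact zeroSet_mem_closedDiscreteSets fun z _ => f.2 z

theorem exists_homeomorph_realAnalyticFunctions :
    ∃ ψ : MaximalSpectrum realAnalyticFunctions ≃ₜ Theta ℝ,
      ∀ M, (ψ M).1 = zeroSetsOf M.asIdeal := by
  refine exists_homeomorph_zeroSetsOf realAnalyticFunctions_zeroSet_iff
    (fun _ h1 _ h2 => inter_mem_closedDiscreteSets h1 h2) ?_
  intro I f g k hf hg hk h
  have h0 : ∀ x, ((f * f + g * g + k * k : realAnalyticFunctions) : ℝ → ℝ) x ≠ 0 := by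
    intro x hx
    have hx' : (f : ℝ → ℝ) x * (f : ℝ → ℝ) x + (g : ℝ → ℝ) x * (g : ℝ → ℝ) x +
      (k : ℝ → ℝ) x * (k : ℝ → ℝ) x = 0 := hx
    have h1 := mul_self_nonneg ((f : ℝ → ℝ) x)
    have h2 := mul_self_nonneg ((g : ℝ → ℝ) x)
    have h3 := mul_self_nonneg ((k : ℝ → ℝ) x)
    exact h x (mul_self_eq_zero.1 (by linarith)) (mul_self_eq_zero.1 (by linarith))
      (mul_self_eq_zero.1 (by linarith))
  refine I.eq_top_of_unit_mem (f * f + g * g + k * k)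
    ⟨fun x => (((f * f + g * g + k * k : realAnalyticFunctions) : ℝ → ℝ) x)⁻¹,
      fun x => ((f * f + g * g + k * k).2 x).inv (h0 x)⟩
    (I.add_mem (I.add_mem (I.mul_mem_left _ hf) (I.mul_mem_left _ hg)) (I.mul_mem_left _ hk)) ?_
  exact Subtype.ext (funext fun x => inv_mul_cancel₀ (h0 x))

open scoped ComplexConjugate in
theorem differentiable_conj_conj {f : ℂ → ℂ} (hf : Differentiable ℂ f) :
    Differentiable ℂ fun z => conj (f (conj z)) :=
  fun _ => differentiableAt_conj_conj_iff.2 (hf _)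

open scoped ComplexConjugate in
theorem mem_realEntireFunctions_iff {f : ℂ → ℂ} :
    f ∈ realEntireFunctions ↔ Differentiable ℂ f ∧ ∀ z, conj (f (conj z)) = f z := by
  constructor
  · rintro ⟨a, ha⟩
    constructor
    · intro z
      have hs : Summable fun n => ‖(a n : ℂ) * ((‖z‖ + 1 : ℝ) : ℂ) ^ n‖ :=
        (ha ((‖z‖ + 1 : ℝ) : ℂ)).summable.norm
      have hd := Complex.differentiableOn_tsum_of_summable_norm (F := fun n z => (a n : ℂ) * z ^ n)
        (U := Metric.ball (0 : ℂ) (‖z‖ + 1)) hs (fun n => by fun_prop) Metric.isOpen_ball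
        (fun n w hw => by
          have h1 : ‖w‖ ≤ ‖z‖ + 1 := (mem_ball_zero_iff.1 hw).le
          rw [norm_mul, norm_mul, norm_pow, norm_pow, Complex.norm_real (‖z‖ + 1),
            Real.norm_of_nonneg (by positivity : 0 ≤ ‖z‖ + 1)]
          gcongr)
      have e : (fun w => ∑' n, (a n : ℂ) * w ^ n) = f := funext fun w => (ha w).tsum_eq
      rw [e] at hd
      exact hd.differentiableAt (Metric.isOpen_ball.mem_nhds (by simp))
    · intro z
      refine (Complex.hasSum_conj'.2 (ha (conj z))).unique ?_
      simpa using ha z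
  · rintro ⟨hd, hc⟩
    -- Averaging the Taylor series with its conjugate reflection replaces each coefficient by its
    -- real part without changing the sum.
    refine ⟨fun n => ((n.factorial : ℂ)⁻¹ * iteratedDeriv n f 0).re, fun z => ?_⟩
    have key : ∀ z, HasSum (fun n : ℕ => (n.factorial : ℂ)⁻¹ * iteratedDeriv n f 0 * z ^ n)
        (f z) := by
      intro z
      refine (iff_of_eq <| congrArg (fun u : ℕ → ℂ => HasSum u _) (funext fun n => ?_)).mpr
        (Complex.hasSum_taylorSeries_of_entire hd 0 z)
      simp only [smul_eq_mul, sub_zero]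
      ring
    have h1 := Complex.hasSum_conj'.2 (key (conj z))
    rw [hc] at h1
    have h2 := ((key z).add h1).div_const 2
    rw [add_self_div_two] at h2
    refine (iff_of_eq <| congrArg (fun u : ℕ → ℂ => HasSum u _) (funext fun n => ?_)).mpr h2
    rw [Complex.re_eq_add_conj, map_mul _ _ (_ ^ n), map_pow, Complex.conj_conj]
    ring

open scoped ComplexConjugate in
theorem realEntireFunctions_zeroSet_iff (Z : Set ℂ) :
    Z ∈ symmetricClosedDiscreteSets ↔ ∃ f : realEntireFunctions, Z = zeroSet (f : ℂ → ℂ) := by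
  constructor
  · rintro ⟨⟨h1, h2⟩ | rfl, hs⟩
    · obtain ⟨f, hf, e⟩ := exists_differentiable_zeroSet_eq h1 h2
      refine ⟨⟨fun z => f z * conj (f (conj z)), mem_realEntireFunctions_iff.2
        ⟨hf.mul (differentiable_conj_conj hf), fun z => ?_⟩⟩, ?_⟩
      · simp [mul_comm]
      · ext z
        simp only [zeroSet, Set.mem_ofPred_eq, mul_eq_zero, map_eq_zero, e]
        refine ⟨Or.inl, ?_⟩
        rintro (h | h)
        · exact h
        · simpa using hs _ h
    · exact ⟨0, by ext; simp [zeroSet]⟩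
  · rintro ⟨f, rfl⟩
    obtain ⟨hd, hc⟩ := mem_realEntireFunctions_iff.1 f.2
    refine ⟨zeroSet_mem_closedDiscreteSets fun z _ => hd.analyticAt z, fun z hz => ?_⟩
    have hz' : (f : ℂ → ℂ) z = 0 := hz
    have h := hc (conj z)
    rw [Complex.conj_conj, hz', map_zero] at h
    exact h.symm

open scoped ComplexConjugate in
theorem exists_homeomorph_realEntireFunctions :
    ∃ ψ : MaximalSpectrum realEntireFunctions ≃ₜ ThetaSymm,
      ∀ M, (ψ M).1 = zeroSetsOf M.asIdeal := by
  refine exists_homeomorph_zeroSetsOf realEntireFunctions_zeroSet_iff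
    (fun _ h1 _ h2 => ⟨inter_mem_closedDiscreteSets h1.1 h2.1,
      fun z hz => ⟨h1.2 z hz.1, h2.2 z hz.2⟩⟩)
    (ideal_eq_top_of_no_common_zero
      (fun t => mem_realEntireFunctions_iff.2 ⟨differentiable_const _, fun z => by simp⟩)
      (fun f hf => (mem_realEntireFunctions_iff.1 hf).1) ?_)
  intro f g h
  obtain ⟨hf, hf'⟩ := mem_realEntireFunctions_iff.1 f.2
  obtain ⟨hg, hg'⟩ := mem_realEntireFunctions_iff.1 g.2
  obtain ⟨u, v, hu, hv, e⟩ := exists_bezout hf hg h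
  -- Since `f` and `g` are invariant under reflection, reflecting `u` and `v` gives a second Bézout
  -- identity; the average of the two has coefficients in the ring.
  have avg : ∀ w : ℂ → ℂ, Differentiable ℂ w →
      (fun z => (w z + conj (w (conj z))) / 2) ∈ realEntireFunctions := fun w hw =>
    mem_realEntireFunctions_iff.2 ⟨(hw.add (differentiable_conj_conj hw)).div_const 2,
      fun z => by
      simp only [map_div₀, map_add, Complex.conj_conj, map_ofNat, add_comm]⟩
  refine ⟨⟨_, avg u hu⟩, ⟨_, avg v hv⟩, Subtype.ext (funext fun z => ?_)⟩
  have e' := congrArg conj (e (conj z))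
  simp only [map_add, map_mul, hf', hg', map_one] at e'
  change (u z + conj (u (conj z))) / 2 * (f : ℂ → ℂ) z +
    (v z + conj (v (conj z))) / 2 * (g : ℂ → ℂ) z = 1
  linear_combination (e z + e') / 2

/-! ### Symmetric and arbitrary closed discrete sets -/

/-- Both sides have the cardinality of `ℂ`, as each contains a copy of a nonempty open half-annulus.
-/
theorem nonempty_equiv_floor_norm_fiber (n : ℕ) :
    Nonempty ({z : {z : ℂ // 0 ≤ z.im} // ⌊‖(z : ℂ)‖⌋₊ = n} ≃ {z : ℂ // ⌊‖z‖⌋₊ = n}) := by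
  have hopen : IsOpen {z : ℂ | 0 < z.im ∧ (n : ℝ) < ‖z‖ ∧ ‖z‖ < n + 1} :=
    (isOpen_lt continuous_const Complex.continuous_im).inter
      ((isOpen_lt continuous_const continuous_norm).inter
        (isOpen_lt continuous_norm continuous_const))
  have hU := cardinal_eq_of_isOpen ℂ hopen ⟨((n + 1 / 2 : ℝ) : ℂ) * Complex.I, by
    have h : (0 : ℝ) < n + 1 / 2 := by positivity
    refine ⟨?_, ?_⟩
    · rw [Complex.im_ofReal_mul, Complex.I_im, mul_one]
      exact h
    · rw [norm_mul, Complex.norm_I, mul_one, Complex.norm_real, Real.norm_of_nonneg h.le]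
      constructor <;> linarith⟩
  have hfl : ∀ z ∈ {z : ℂ | 0 < z.im ∧ (n : ℝ) < ‖z‖ ∧ ‖z‖ < n + 1}, ⌊‖z‖⌋₊ = n :=
    fun z hz => (Nat.floor_eq_iff (norm_nonneg z)).2 ⟨hz.2.1.le, hz.2.2⟩
  have h1 : Cardinal.mk {z : {z : ℂ // 0 ≤ z.im} // ⌊‖(z : ℂ)‖⌋₊ = n} = Cardinal.mk ℂ := by
    refine le_antisymm (Cardinal.mk_le_of_injective (f := fun z => (z.1 : ℂ))
      (Subtype.val_injective.comp Subtype.val_injective)) ?_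
    rw [← hU]
    exact Cardinal.mk_le_of_injective (f := fun z => ⟨⟨z.1, z.2.1.le⟩, hfl z.1 z.2⟩)
      fun z w h => Subtype.ext (congrArg (fun x => (x.1 : ℂ)) h)
  have h2 : Cardinal.mk {z : ℂ // ⌊‖z‖⌋₊ = n} = Cardinal.mk ℂ := by
    refine le_antisymm (Cardinal.mk_subtype_le _) ?_
    rw [← hU]
    exact Cardinal.mk_subtype_le_of_subset fun z hz => hfl z hz
  exact Cardinal.eq.1 (h1.trans h2.symm)

open scoped ComplexConjugate in
/-- A surjection `ℂ → ℂ` identifying exactly the pairs of conjugate points and preserving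
the integer part of the modulus. -/
theorem exists_surjective_conj_quotient : ∃ π : ℂ → ℂ, π.Surjective ∧
    (∀ z w, π z = π w ↔ z = w ∨ z = conj w) ∧ ∀ z, ⌊‖π z‖⌋₊ = ⌊‖z‖⌋₊ := by
  let φ : {z : ℂ // 0 ≤ z.im} ≃ ℂ := Equiv.ofFiberEquiv (f := fun z => ⌊‖(z : ℂ)‖⌋₊)
    (g := fun z => ⌊‖z‖⌋₊) fun n => (nonempty_equiv_floor_norm_fiber n).some
  -- Fold the plane onto the closed upper half-plane, then spread that over `ℂ` one annulus at a
  -- time.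
  refine ⟨fun z => φ ⟨⟨z.re, |z.im|⟩, abs_nonneg _⟩, fun w => ?_, fun z w => ?_, fun z => ?_⟩
  · refine ⟨φ.symm w, ?_⟩
    have h : (⟨(φ.symm w : ℂ).re, |(φ.symm w : ℂ).im|⟩ : ℂ) = φ.symm w :=
      Complex.ext rfl (abs_of_nonneg (φ.symm w).2)
    simp only [h, Subtype.coe_eta, Equiv.apply_symm_apply]
  · simp only [φ.injective.eq_iff, Subtype.mk.injEq, Complex.ext_iff,
      Complex.conj_re, Complex.conj_im, abs_eq_abs]
    tauto
  · rw [show ⌊‖φ ⟨⟨z.re, |z.im|⟩, abs_nonneg _⟩‖⌋₊ = ⌊‖(⟨z.re, |z.im|⟩ : ℂ)‖⌋₊ from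
      Equiv.ofFiberEquiv_map (g := fun z : ℂ => ⌊‖z‖⌋₊) _ _]
    simp [Complex.norm_def, Complex.normSq_apply]

open scoped ComplexConjugate in
theorem nonempty_thetaSymm_homeomorph_theta : Nonempty (ThetaSymm ≃ₜ Theta ℂ) := by
  obtain ⟨π, hs, hπ, hfl⟩ := exists_surjective_conj_quotient
  have hconj : ∀ z, π (conj z) = π z := fun z => (hπ _ _).2 (Or.inr rfl)
  have hfib : ∀ b, (π ⁻¹' {b}).Finite := by
    intro b
    obtain ⟨w, rfl⟩ := hs b
    refine (Set.toFinite {w, conj w}).subset fun z hz => ?_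
    exact (hπ z w).1 hz
  refine nonempty_homeomorph_of_preimage hs (fun T => ?_) fun S hS => ⟨π '' S, ?_⟩
  · have hT : ∀ n : ℕ, π ⁻¹' T ∩ {z | ⌊‖z‖⌋₊ = n} = π ⁻¹' (T ∩ {z | ⌊‖z‖⌋₊ = n}) := fun n => by
      ext z
      simp [hfl]
    have h1 : (IsClosed (π ⁻¹' T) ∧ IsDiscrete (π ⁻¹' T)) ↔ (IsClosed T ∧ IsDiscrete T) := by
      simp only [isClosed_and_isDiscrete_iff_finite, hT]
      -- Fibres of `π` have at most two points, so finiteness passes both ways.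
      exact forall_congr' fun n => ⟨fun h => h.of_preimage hs, fun h => h.preimage' fun b _ => hfib b⟩
    have h2 : π ⁻¹' T = Set.univ ↔ T = Set.univ :=
      hs.preimage_injective.eq_iff' Set.preimage_univ
    refine Iff.trans ?_ (or_congr h1 h2)
    refine and_iff_left fun z hz => ?_
    rwa [Set.mem_preimage, hconj]
  · refine (Set.subset_preimage_image π S).antisymm ?_
    rintro z ⟨w, hw, e⟩
    rcases (hπ w z).1 e with rfl | rfl
    · exact hw
    · simpa using hS.2 _ hw

theorem theorem3p6 :
    (∃ ψ : MaximalSpectrum entireFunctions ≃ₜ Theta ℂ,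
      ∀ M, (ψ M).1 = zeroSetsOf M.asIdeal) ∧
    (∃ ψ : MaximalSpectrum realAnalyticFunctions ≃ₜ Theta ℝ,
      ∀ M, (ψ M).1 = zeroSetsOf M.asIdeal) ∧
    (∃ ψ : MaximalSpectrum realEntireFunctions ≃ₜ ThetaSymm,
      ∀ M, (ψ M).1 = zeroSetsOf M.asIdeal) ∧
    Nonempty (MaximalSpectrum realEntireFunctions ≃ₜ Theta ℂ) := by
  refine ⟨exists_homeomorph_entireFunctions, exists_homeomorph_realAnalyticFunctions,
    exists_homeomorph_realEntireFunctions, ?_⟩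
  obtain ⟨ψ, -⟩ := exists_homeomorph_realEntireFunctions
  obtain ⟨e⟩ := nonempty_thetaSymm_homeomorph_theta
  exact ⟨ψ.trans e⟩
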